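/- Theorem 3.6. Let $G$ be a locally compact (Hausdorff) group, $H$ a closed subgroup of $G$ and $L$ a closed subgroup of $H$, with modular functions satisfying $\Delta_G|_L=\Delta_H|_L=\Delta_L$; here $\int_G f(y)\,dy=\Delta_G(x)\int_G f(yx)\,dy$ for $f\in C_c(G)$ and left Haar measure $dy$, and similarly for $H$ and $L$. Let $\rho$ be any rho-function for the pair $(G,H)$, that is, a non-negative locally integrable function on $G$ (with respect to Haar measure) such that $\rho(xh)=\Delta_H(h)\Delta_G(h)^{-1}\rho(x)$ for all $x\in G$, $h\in H$. Then $\rho(xl)=\rho(x)$ for $l\in L$, and we write $\rho(xL):=\rho(x)$. Let $\nu$ be a $G$-invariant Radon measure on $G/L$ and let $\eta\neq 0$ be an $H$-invariant Radon measure on $H/L$. For complex-valued $f\in C_c(G/L)$ put $$R_{L,H}f(xH)=\int_{H/L} f(xhL)\,d\eta(hL)\qquad(x\in G).$$ Then there is a regular Borel measure $\mu$ on $G/H$ such that for every $f\in C_c(G/L)$ the function $R_{L,H}f$ is $\mu$-integrable, the function $xL\mapsto\rho(xL)f(xL)$ is $\nu$-integrable, and $$\int_{G/H}R_{L,H}f(xH)\,d\mu(xH)=\int_{G/L}\rho(xL)\,f(xL)\,d\nu(xL).$$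 -/

import Mathlib

open MeasureTheory
open scoped CompactlySupported

noncomputable section

/-- The space `G/L` of left cosets `xL` of a subgroup `L` of a topological group `G`. It carries the
quotient topology, the left translation action of `G`, and its Borel σ-algebra. (A separate name is
used because Mathlib puts the quotient σ-algebra on `G ⧸ L`; the latter can be larger than the Borel
σ-algebra when `G` is not second countable.) -/
def CosetSpace (G : Type*) [Group G] (L : Subgroup G) : Type _ := G ⧸ L

namespace CosetSpace

instance (G : Type*) [Group G] [TopologicalSpace G] (L : Subgroup G) :
    TopologicalSpace (CosetSpace G L) :=
  inferInstanceAs (TopologicalSpace (G ⧸ L))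

instance (G : Type*) [Group G] (L : Subgroup G) : MulAction G (CosetSpace G L) :=
  inferInstanceAs (MulAction G (G ⧸ L))

instance (G : Type*) [Group G] [TopologicalSpace G] [IsTopologicalGroup G] (L : Subgroup G) :
    ContinuousConstSMul G (CosetSpace G L) :=
  inferInstanceAs (ContinuousConstSMul G (G ⧸ L))

instance (G : Type*) [Group G] [TopologicalSpace G] (L : Subgroup G) :
    MeasurableSpace (CosetSpace G L) :=
  borel (CosetSpace G L)

instance (G : Type*) [Group G] [TopologicalSpace G] (L : Subgroup G) :
    BorelSpace (CosetSpace G L) :=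
  ⟨rfl⟩

/-- The coset `xL`. -/
def mk {G : Type*} [Group G] (L : Subgroup G) (x : G) : CosetSpace G L :=
  QuotientGroup.mk (s := L) x

/-- A function on `G` that is constant on the cosets `xL`, regarded as a function on `G/L`. -/
def lift {G : Type*} [Group G] {L : Subgroup G} {α : Type*} (φ : G → α)
    (hφ : ∀ (x : G) (l : L), φ (x * l) = φ x) : CosetSpace G L → α :=
  Quotient.lift φ (by
    intro a b hab
    have h : a⁻¹ * b ∈ L := QuotientGroup.leftRel_apply.mp hab
    have := hφ a ⟨a⁻¹ * b, h⟩
    simpa using this.symm)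

@[simp] theorem lift_mk {G : Type*} [Group G] {L : Subgroup G} {α : Type*} (φ : G → α)
    (hφ : ∀ (x : G) (l : L), φ (x * l) = φ x) (x : G) : lift φ hφ (mk L x) = φ x := rfl

theorem smul_mk {G : Type*} [Group G] (L : Subgroup G) (x y : G) :
    x • mk L y = mk L (x * y) := rfl

theorem mk_surjective {G : Type*} [Group G] (L : Subgroup G) :
    Function.Surjective (mk L) := Quotient.mk_surjective

/-- The map `H/L → G/L`, `hL ↦ hL`. -/
def incl {G : Type*} [Group G] (L H : Subgroup G) :
    CosetSpace H (L.subgroupOf H) → CosetSpace G L :=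
  lift (fun h : H => mk L (h : G)) (by
    intro h l
    refine QuotientGroup.eq.mpr ?_
    have hl : ((l : H) : G) ∈ L := Subgroup.mem_subgroupOf.mp l.2
    simpa using L.inv_mem hl)

theorem incl_mk {G : Type*} [Group G] (L H : Subgroup G) (h : H) :
    incl L H (mk (L.subgroupOf H) h) = mk L (h : G) := rfl

theorem incl_smul {G : Type*} [Group G] (L H : Subgroup G) (h : H)
    (z : CosetSpace H (L.subgroupOf H)) : incl L H (h • z) = (h : G) • incl L H z := by
  obtain ⟨k, rfl⟩ := mk_surjective _ z
  rfl

end CosetSpace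

/-- The modular function `Δ_G`, normalised by
`∫ f(y) dy = Δ_G(x) ∫ f(yx) dy` for the left Haar measure `dy` on `G`. Mathlib's
`modularCharacter` is normalised by `∫ f(yx) dy = modularCharacter x * ∫ f(y) dy`, so that `Δ_G` is
its reciprocal. -/
def modularFunction {G : Type*} [Group G] [TopologicalSpace G] [IsTopologicalGroup G]
    [LocallyCompactSpace G] (x : G) : ℝ :=
  ((Measure.modularCharacter x : NNReal) : ℝ)⁻¹

/-- The modular function `Δ_H` of a closed subgroup `H` of a locally compact group. -/
def subgroupModularFunction {G : Type*} [Group G] [TopologicalSpace G] [IsTopologicalGroup G]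
    [LocallyCompactSpace G] (H : Subgroup G) (hH : IsClosed (H : Set G)) (h : H) : ℝ :=
  haveI : LocallyCompactSpace H := hH.isClosedEmbedding_subtypeVal.locallyCompactSpace
  modularFunction h

theorem modularFunction_pos {G : Type*} [Group G] [TopologicalSpace G] [IsTopologicalGroup G]
    [LocallyCompactSpace G] (x : G) : 0 < modularFunction x :=
  inv_pos.mpr (NNReal.coe_pos.mpr (Measure.modularCharacterFun_pos x))

/-- A rho-function for the pair `(G, H)`: a non-negative function on `G`, locally integrable for
Haar measure, with `ρ(xh) = Δ_H(h) Δ_G(h)⁻¹ ρ(x)` for `x ∈ G`, `h ∈ H`. -/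
structure IsRhoFunction {G : Type*} [Group G] [TopologicalSpace G] [IsTopologicalGroup G]
    [LocallyCompactSpace G] [MeasurableSpace G] [BorelSpace G]
    (H : Subgroup G) (hH : IsClosed (H : Set G)) (ρ : G → ℝ) : Prop where
  nonneg : ∀ x, 0 ≤ ρ x
  locallyIntegrable : LocallyIntegrable ρ (Measure.haar : Measure G)
  apply_mul : ∀ (x : G) (h : H),
    ρ (x * h) = subgroupModularFunction H hH h * (modularFunction (h : G))⁻¹ * ρ x

/-- A rho-function for `(G, H)` as a function `xL ↦ ρ(x)` on `G/L`, for a subgroup `L` of `H` on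
which `Δ_G` and `Δ_H` agree. -/
def IsRhoFunction.onCosetSpace {G : Type*} [Group G] [TopologicalSpace G] [IsTopologicalGroup G]
    [LocallyCompactSpace G] [MeasurableSpace G] [BorelSpace G]
    {H : Subgroup G} {hH : IsClosed (H : Set G)} {ρ : G → ℝ} (hρ : IsRhoFunction H hH ρ)
    {L : Subgroup G} (hLH : L ≤ H)
    (hΔ : ∀ l : L, modularFunction (l : G) =
      subgroupModularFunction H hH (Subgroup.inclusion hLH l)) :
    CosetSpace G L → ℝ :=
  CosetSpace.lift ρ (by
    intro x l
    have h := hρ.apply_mul x (Subgroup.inclusion hLH l)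
    rw [← hΔ l, Subgroup.coe_inclusion, mul_inv_cancel₀ (modularFunction_pos _).ne',
      one_mul] at h
    exact h)

/-- The Radon transform `R_{L,H} f (xH) = ∫_{H/L} f(xhL) dη(hL)`, for an `H`-invariant measure `η`
on `H/L`. -/
def radonTransform {G : Type*} [Group G] [TopologicalSpace G] [IsTopologicalGroup G]
    (L H : Subgroup G) (η : Measure (CosetSpace H (L.subgroupOf H)))
    [SMulInvariantMeasure H (CosetSpace H (L.subgroupOf H)) η]
    (f : CosetSpace G L → ℂ) : CosetSpace G H → ℂ :=
  CosetSpace.lift (fun x : G => ∫ z, f (x • CosetSpace.incl L H z) ∂η) (by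
    intro x h
    have := integral_smul_eq_self (μ := η) (fun z => f (x • CosetSpace.incl L H z)) (g := h)
    simpa only [CosetSpace.incl_smul, mul_smul] using this)

end

noncomputable section

open Filter Topology Set
open scoped NNReal ENNReal Pointwise

/-! ### Topology of coset spaces. -/

namespace CosetSpace

/-! Write `P_L φ(xL) = ∫_L φ(xl) dl`. Integrating `P_L φ` against an invariant measure is a left
invariant positive functional of `φ`, so uniqueness of Haar measure gives Weil's formulas `∫ P_L φ
dν = c ∫_G φ` on `G/L` and, with a constant `c'`, on `H/L`; `c' ≠ 0` because `η ≠ 0`. The functional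
`φ ↦ ∫_G ρφ` scales under right translation by `H` exactly so as to factor through `P_H`, hence
there is a regular `μ₀` on `G/H` with `∫ P_H φ dμ₀ = ∫_G ρφ`.

Given `f`, choose `χ ∈ C_c(G)` with `P_L χ = 1` on its support and put `φ(x) = χ(x) f(xL)`. Weil's
formula on each fibre gives `R f = c' P_H φ`, while on `G/L` it gives `∫ ρf dν = c ∫_G ρφ = c ∫ P_H
φ dμ₀`. So `μ = (c/c') μ₀` works.

The delicate point is that `ρ` is only locally integrable and `G` need not be σ-compact. Weil's
formula is therefore upgraded to an identity of finite inner regular measures, and measurability of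
`ρ` descends to `G/L` by exhausting sets with compacts, whose images are again compact. -/

theorem isOpenQuotientMap_mk {G : Type*} [Group G] [TopologicalSpace G] [IsTopologicalGroup G]
    (L : Subgroup G) : IsOpenQuotientMap (mk L) :=
  QuotientGroup.isOpenQuotientMap_mk (N := L)

theorem continuous_mk {G : Type*} [Group G] [TopologicalSpace G] [IsTopologicalGroup G]
    (L : Subgroup G) : Continuous (mk L) :=
  (isOpenQuotientMap_mk L).continuous

instance {G : Type*} [Group G] [TopologicalSpace G] [IsTopologicalGroup G]
    [LocallyCompactSpace G] (L : Subgroup G) : LocallyCompactSpace (CosetSpace G L) :=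
  (isOpenQuotientMap_mk L).locallyCompactSpace

theorem t2Space_of_isClosed {G : Type*} [Group G] [TopologicalSpace G] [IsTopologicalGroup G]
    {L : Subgroup G} (hL : IsClosed (L : Set G)) : T2Space (CosetSpace G L) :=
  inferInstanceAs (T2Space (G ⧸ L))

theorem mk_mul_mem {G : Type*} [Group G] {L : Subgroup G} (x : G) (l : L) :
    mk L (x * l) = mk L x :=
  QuotientGroup.mk_mul_of_mem x l.2

/-- Every compact subset of `G/L` is covered by the image of a compact subset of `G`. -/
theorem exists_isCompact_image_superset {G : Type*} [Group G] [TopologicalSpace G]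
    [IsTopologicalGroup G] [LocallyCompactSpace G] {L : Subgroup G} {C : Set (CosetSpace G L)}
    (hC : IsCompact C) : ∃ K : Set G, IsCompact K ∧ C ⊆ mk L '' K := by
  choose N hN hN' using fun x : G => exists_compact_mem_nhds x
  obtain ⟨t, ht⟩ := hC.elim_nhds_subcover' (fun z _ => mk L '' N z.out) (fun z _ => by
    have := (isOpenQuotientMap_mk L).isOpenMap.image_mem_nhds (hN' z.out)
    have e : mk L z.out = z := Quotient.out_eq z
    rwa [e] at this)
  refine ⟨⋃ z ∈ t, N z.1.out, t.isCompact_biUnion fun z _ => hN _, ?_⟩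
  simpa only [image_iUnion] using ht

end CosetSpace

open CosetSpace

theorem hasCompactSupport_mul_subgroup {G E : Type*} [Group G] [TopologicalSpace G]
    [IsTopologicalGroup G] [Zero E] {L : Subgroup G} (hL : IsClosed (L : Set G))
    {f : G → E} (hf' : HasCompactSupport f) (x : G) :
    HasCompactSupport fun l : L => f (x * l) :=
  (hf'.comp_homeomorph (Homeomorph.mulLeft x)).comp_isClosedEmbedding
    hL.isClosedEmbedding_subtypeVal

theorem integrable_mul_subgroup {G E : Type*} [Group G] [TopologicalSpace G]
    [IsTopologicalGroup G] [MeasurableSpace G] [BorelSpace G] [NormedAddCommGroup E]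
    {L : Subgroup G} (hL : IsClosed (L : Set G))
    (lam : Measure L) [IsFiniteMeasureOnCompacts lam] (f : C_c(G, E)) (x : G) :
    Integrable (fun l : L => f (x * l)) lam :=
  (f.continuous.comp (continuous_const.mul continuous_subtype_val)).integrable_of_hasCompactSupport
    (hasCompactSupport_mul_subgroup hL f.hasCompactSupport x)

/-! ### Averaging functions over cosets. -/

section MulPullback

variable {G : Type*} [Group G] [TopologicalSpace G] [IsTopologicalGroup G] {L : Subgroup G}
  {E : Type*} [NormedAddCommGroup E] [NormedSpace ℝ E]

/-- The product of a scalar function in `C_c(G)` with the pullback of a function on `G/L`. -/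
def mulPullback (χ : C_c(G, ℝ)) (g : CosetSpace G L → E) (hg : Continuous g) : C_c(G, E) where
  toFun x := χ x • g (mk L x)
  continuous_toFun := χ.continuous.smul (hg.comp (continuous_mk L))
  hasCompactSupport' := χ.hasCompactSupport.smul_right

theorem mulPullback_apply (χ : C_c(G, ℝ)) (g : CosetSpace G L → E) (hg : Continuous g) (x : G) :
    mulPullback χ g hg x = χ x • g (mk L x) := rfl

end MulPullback

section CosetIntegral

variable {G : Type*} [Group G] [TopologicalSpace G] [IsTopologicalGroup G]
  [LocallyCompactSpace G] [MeasurableSpace G] [BorelSpace G]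
  {E : Type*} [NormedAddCommGroup E] [NormedSpace ℝ E]

theorem continuous_integral_mul_subgroup {L : Subgroup G} (hL : IsClosed (L : Set G))
    (lam : Measure L) [IsFiniteMeasureOnCompacts lam] {f : G → E} (hf : Continuous f)
    (hf' : HasCompactSupport f) : Continuous fun x : G => ∫ l : L, f (x * l) ∂lam := by
  refine continuous_iff_continuousAt.2 fun x₀ => ?_
  obtain ⟨t, t_comp, ht⟩ := exists_compact_mem_nhds x₀
  have hk : IsCompact ((↑) ⁻¹' (t⁻¹ * tsupport f) : Set L) :=
    hL.isClosedEmbedding_subtypeVal.isCompact_preimage (t_comp.inv.mul hf')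
  refine ContinuousOn.continuousAt (s := t) ?_ ht
  refine continuousOn_integral_of_compact_support hk ?_ ?_
  · exact (hf.comp (continuous_fst.mul (continuous_subtype_val.comp continuous_snd))).continuousOn
  · intro x l hx hl
    contrapose! hl
    exact ⟨x⁻¹, Set.inv_mem_inv.mpr hx, x * l, subset_tsupport _ hl, by simp⟩

/-- The map `f ↦ (xL ↦ ∫_L f(xl) dl)` from `C_c(G)` to `C_c(G/L)`. -/
def cosetIntegral {L : Subgroup G} (hL : IsClosed (L : Set G)) (lam : Measure L)
    [IsFiniteMeasureOnCompacts lam] [lam.IsMulLeftInvariant] :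
    C_c(G, E) →ₗ[ℝ] C_c(CosetSpace G L, E) where
  toFun f :=
    { toFun := CosetSpace.lift (fun x : G => ∫ l : L, f (x * l) ∂lam) (by
        intro x l
        simpa [mul_assoc] using integral_mul_left_eq_self (μ := lam) (fun k : L => f (x * k)) l)
      continuous_toFun := (isOpenQuotientMap_mk L).continuous_comp_iff.mp
        (continuous_integral_mul_subgroup hL lam f.continuous f.hasCompactSupport)
      hasCompactSupport' := by
        have := t2Space_of_isClosed hL
        refine HasCompactSupport.intro (f.hasCompactSupport.image (continuous_mk L)) ?_
        intro z hz
        obtain ⟨x, rfl⟩ := mk_surjective L z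
        rw [lift_mk]
        refine integral_eq_zero_of_ae (.of_forall fun l => ?_)
        by_contra h
        exact hz ⟨x * l, subset_tsupport _ h, mk_mul_mem x l⟩ }
  map_add' f g := by
    ext z
    obtain ⟨x, rfl⟩ := mk_surjective L z
    exact integral_add (integrable_mul_subgroup hL lam f x) (integrable_mul_subgroup hL lam g x)
  map_smul' c f := by
    ext z
    obtain ⟨x, rfl⟩ := mk_surjective L z
    exact integral_smul c _

variable {L : Subgroup G} (hL : IsClosed (L : Set G)) (lam : Measure L)
    [IsFiniteMeasureOnCompacts lam] [lam.IsMulLeftInvariant]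

theorem cosetIntegral_mk (f : C_c(G, E)) (x : G) :
    cosetIntegral hL lam f (mk L x) = ∫ l : L, f (x * l) ∂lam := rfl

theorem cosetIntegral_nonneg {f : C_c(G, ℝ)} (hf : ∀ x, 0 ≤ f x) (z : CosetSpace G L) :
    0 ≤ cosetIntegral hL lam f z := by
  obtain ⟨x, rfl⟩ := mk_surjective L z
  exact integral_nonneg fun l => hf _

theorem cosetIntegral_mulPullback [CompleteSpace E] (χ : C_c(G, ℝ)) (g : CosetSpace G L → E)
    (hg : Continuous g) (z : CosetSpace G L) :
    cosetIntegral hL lam (mulPullback χ g hg) z = cosetIntegral hL lam χ z • g z := by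
  obtain ⟨x, rfl⟩ := mk_surjective L z
  simp only [cosetIntegral_mk, mulPullback_apply, mk_mul_mem]
  exact integral_smul_const _ _

/-- A compact subset of `G/L` carries a nonnegative function in `C_c(G)` whose integrals over the
cosets in that subset are all `1`. -/
theorem exists_cosetIntegral_eq_one [T2Space G] [lam.IsOpenPosMeasure] {C : Set (CosetSpace G L)}
    (hC : IsCompact C) :
    ∃ χ : C_c(G, ℝ), (∀ x, 0 ≤ χ x) ∧ ∀ z ∈ C, cosetIntegral hL lam χ z = 1 := by
  obtain ⟨K, hK, hCK⟩ := exists_isCompact_image_superset hC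
  obtain ⟨f, hf1, hf2, -, hf4⟩ :=
    exists_continuousMap_one_of_isCompact_subset_isOpen hK isOpen_univ K.subset_univ
  let χ₀ : C_c(G, ℝ) := ⟨f, hf2⟩
  have hχ₀ : ∀ x, 0 ≤ χ₀ x := fun x => (hf4 x).1
  have hpos : ∀ z ∈ C, 0 < cosetIntegral hL lam χ₀ z := by
    intro z hz
    obtain ⟨x, hx, rfl⟩ := hCK hz
    rw [cosetIntegral_mk]
    refine Continuous.integral_pos_of_hasCompactSupport_nonneg_nonzero (x := (1 : L))
      (χ₀.continuous.comp (continuous_const.mul continuous_subtype_val))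
      (hasCompactSupport_mul_subgroup hL χ₀.hasCompactSupport x) (fun l => hχ₀ _) ?_
    have : χ₀ x = 1 := hf1 hx
    simp [this]
  obtain ⟨ε, hε, hεC⟩ : ∃ ε > 0, ∀ z ∈ C, ε ≤ cosetIntegral hL lam χ₀ z := by
    rcases C.eq_empty_or_nonempty with rfl | hne
    · exact ⟨1, one_pos, by simp⟩
    · obtain ⟨z, hz, hmin⟩ := hC.exists_isMinOn hne (cosetIntegral hL lam χ₀).continuous.continuousOn
      exact ⟨_, hpos z hz, fun w hw => hmin hw⟩
  -- Normalise by the coset integral; the cutoff at `ε` is inactive on `C` and keeps the reciprocal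
  -- continuous elsewhere.
  let g : CosetSpace G L → ℝ := fun z => (max (cosetIntegral hL lam χ₀ z) ε)⁻¹
  have hg : Continuous g :=
    ((cosetIntegral hL lam χ₀).continuous.max continuous_const).inv₀
      fun z => (lt_max_of_lt_right hε).ne'
  refine ⟨mulPullback χ₀ g hg, fun x => ?_, fun z hz => ?_⟩
  · exact mul_nonneg (hχ₀ x) (inv_nonneg.mpr (hε.le.trans (le_max_right _ _)))
  · rw [cosetIntegral_mulPullback]
    simp [g, max_eq_left (hεC z hz), (hpos z hz).ne']

end CosetIntegral

/-! ### Haar uniqueness and the modular character. -/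

section ModularCharacter

open Measure

theorem modularCharacter_pos {G : Type*} [Group G] [TopologicalSpace G] [IsTopologicalGroup G]
    [LocallyCompactSpace G] (x : G) :
    0 < ((modularCharacter x : ℝ≥0) : ℝ) :=
  NNReal.coe_pos.mpr (modularCharacterFun_pos x)

variable {G : Type*} [Group G] [TopologicalSpace G] [IsTopologicalGroup G]
  [LocallyCompactSpace G] [MeasurableSpace G] [BorelSpace G]

/-- A left invariant positive functional on `C_c(G)` is a multiple of the Haar integral. -/
theorem exists_eq_integral_of_leftInvariant [T2Space G] (m : Measure G) [m.IsHaarMeasure]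
    (Λ : C_c(G, ℝ) →ₗ[ℝ] ℝ) (hpos : ∀ f : C_c(G, ℝ), (∀ x, 0 ≤ f x) → 0 ≤ Λ f)
    (hinv : ∀ (f f' : C_c(G, ℝ)) (y : G), (∀ x, f' x = f (y * x)) → Λ f' = Λ f) :
    ∃ c : ℝ≥0, ∀ f : C_c(G, ℝ), Λ f = c * ∫ x, f x ∂m := by
  let Λ' : C_c(G, ℝ) →ₚ[ℝ] ℝ := PositiveLinearMap.mk₀ Λ fun f hf => hpos f hf
  let m' := RealRMK.rieszMeasure Λ'
  have hm' : ∀ f : C_c(G, ℝ), ∫ x, f x ∂m' = Λ f := fun f => RealRMK.integral_rieszMeasure Λ' f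
  have : m'.IsMulLeftInvariant := ⟨fun y => by
    have : (m'.map (y * ·)).Regular := Regular.map (Homeomorph.mulLeft y)
    refine ext_of_integral_eq_on_compactlySupported fun f => ?_
    rw [integral_map (by fun_prop) (by fun_prop), hm' f,
      ← hinv f (f.comp (Homeomorph.mulLeft y).toCocompactMap) y fun x => rfl, ← hm']
    rfl⟩
  refine ⟨haarScalarFactor m' m, fun f => ?_⟩
  rw [← hm' f]
  refine (integral_isMulLeftInvariant_eq_smul_of_hasCompactSupport m' m f.continuous
    f.hasCompactSupport).trans ?_
  rw [integral_smul_nnreal_measure]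
  rfl

theorem map_mul_right_eq_modularCharacter_smul (m : Measure G) [m.IsHaarMeasure] [m.Regular]
    (x : G) : m.map (· * x) = (modularCharacter x : ℝ≥0) • m := by
  have : (m.map (· * x)).Regular := Regular.map (Homeomorph.mulRight x)
  rw [isMulLeftInvariant_eq_smul_of_regular (m.map (· * x)) m]
  exact congrArg (· • m) (modularCharacterFun_eq_haarScalarFactor m x).symm

theorem integral_mul_right_eq_modularCharacter {E : Type*} [NormedAddCommGroup E]
    [NormedSpace ℝ E] (m : Measure G) [m.IsHaarMeasure] [m.Regular] (f : G → E) (x : G) :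
    ∫ y, f (y * x) ∂m = (modularCharacter x : ℝ) • ∫ y, f y ∂m := by
  have := (Homeomorph.mulRight x).measurableEmbedding.integral_map (μ := m) f
  simp only [Homeomorph.coe_mulRight] at this
  rw [← this, map_mul_right_eq_modularCharacter_smul, integral_smul_nnreal_measure]
  rfl

/-- The character is the ratio of `∫ f(yx) dy` to `∫ f(y) dy` for a fixed bump `f`, and the
numerator is continuous in `x`. -/
theorem continuous_modularCharacter [T2Space G] :
    Continuous fun x : G => ((modularCharacter x : ℝ≥0) : ℝ) := by
  let m : Measure G := haar
  obtain ⟨⟨f, f_cont⟩, f_comp, f_nonneg, f_one⟩ :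
    ∃ f : C(G, ℝ), HasCompactSupport f ∧ 0 ≤ f ∧ f 1 ≠ 0 := exists_continuous_nonneg_pos 1
  have hf : 0 < ∫ y, f y ∂m :=
    f_cont.integral_pos_of_hasCompactSupport_nonneg_nonzero f_comp f_nonneg f_one
  have key : ∀ x : G, ((modularCharacter x : ℝ≥0) : ℝ) = (∫ y, f (y * x) ∂m) / ∫ y, f y ∂m := by
    intro x
    have := integral_mul_right_eq_modularCharacter m f x
    rw [this, smul_eq_mul, mul_div_cancel_right₀ _ hf.ne']
  simp_rw [key]
  refine Continuous.div_const ?_ _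
  refine continuous_iff_continuousAt.2 fun x₀ => ?_
  obtain ⟨t, t_comp, ht⟩ := exists_compact_mem_nhds x₀
  refine ContinuousOn.continuousAt (s := t) ?_ ht
  refine continuousOn_integral_of_compact_support (f_comp.isCompact.mul t_comp.inv) ?_ ?_
  · exact (f_cont.comp (continuous_snd.mul continuous_fst)).continuousOn
  · intro x y hx hy
    contrapose! hy
    exact ⟨y * x, subset_tsupport _ hy, x⁻¹, Set.inv_mem_inv.mpr hx, by simp⟩

/-- `f ↦ (x ↦ Δ(x)⁻¹ f(x⁻¹))` on `C_c(G)`. -/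
def modularInversion [T2Space G] : C_c(G, ℝ) →ₗ[ℝ] C_c(G, ℝ) where
  toFun f :=
    { toFun := fun x => ((modularCharacter x : ℝ≥0) : ℝ) * f x⁻¹
      continuous_toFun := continuous_modularCharacter.mul (f.continuous.comp continuous_inv)
      hasCompactSupport' := (f.hasCompactSupport.comp_homeomorph (Homeomorph.inv G)).mul_left }
  map_add' f g := by ext; exact mul_add _ _ _
  map_smul' c f := by ext; exact mul_left_comm _ _ _

theorem modularInversion_apply [T2Space G] (f : C_c(G, ℝ)) (x : G) :
    modularInversion f x = ((modularCharacter x : ℝ≥0) : ℝ) * f x⁻¹ := rfl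

/-- Left Haar measure is multiplied by the reciprocal modular function under inversion. -/
theorem integral_modularInversion [T2Space G] (m : Measure G) [m.IsHaarMeasure] [m.Regular]
    (f : C_c(G, ℝ)) : ∫ x, modularInversion f x ∂m = ∫ x, f x ∂m := by
  have hint : ∀ f : C_c(G, ℝ), Integrable f m := fun f =>
    f.continuous.integrable_of_hasCompactSupport f.hasCompactSupport
  let Λ : C_c(G, ℝ) →ₗ[ℝ] ℝ :=
    { toFun := fun f => ∫ x, modularInversion f x ∂m
      map_add' := fun f g => by
        rw [map_add]; exact integral_add (hint _) (hint _)
      map_smul' := fun c f => by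
        rw [map_smul]; exact integral_smul c _ }
  obtain ⟨c, hc⟩ := exists_eq_integral_of_leftInvariant m Λ
    (fun f hf => integral_nonneg fun x => mul_nonneg (modularCharacter_pos x).le (hf _)) (by
      intro f f' y h
      -- Inversion turns left translation by `y` into right translation by `y⁻¹`; the factor this
      -- produces in the Haar integral cancels the one displayed here.
      have e : ∀ x, modularInversion f' x
          = (modularCharacter y : ℝ) * modularInversion f (x * y⁻¹) := by
        intro x
        simp only [modularInversion_apply, h, map_mul, mul_inv_rev, inv_inv,
          NNReal.coe_mul, map_inv]
        have := (modularCharacter_pos y).ne'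
        push_cast
        field_simp
      change ∫ x, modularInversion f' x ∂m = ∫ x, modularInversion f x ∂m
      simp_rw [e]
      rw [integral_const_mul, integral_mul_right_eq_modularCharacter m (modularInversion f),
        smul_eq_mul, ← mul_assoc, ← NNReal.coe_mul, ← map_mul]
      simp)
  -- The operator is an involution, so `c² = 1`, and `c ≥ 0` leaves `c = 1`.
  have hinvol : ∀ f : C_c(G, ℝ), modularInversion (modularInversion f) = f := by
    intro f
    ext x
    rw [modularInversion_apply, modularInversion_apply, ← mul_assoc, ← NNReal.coe_mul, ← map_mul]
    simp
  have hc' : ∀ f : C_c(G, ℝ), ∫ x, modularInversion f x ∂m = c * ∫ x, f x ∂m := hc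
  obtain ⟨⟨g, g_cont⟩, g_comp, g_nonneg, g_one⟩ :
    ∃ g : C(G, ℝ), HasCompactSupport g ∧ 0 ≤ g ∧ g 1 ≠ 0 := exists_continuous_nonneg_pos 1
  have hg : 0 < ∫ y, g y ∂m :=
    g_cont.integral_pos_of_hasCompactSupport_nonneg_nonzero g_comp g_nonneg g_one
  have hcc := hc' (modularInversion ⟨⟨g, g_cont⟩, g_comp⟩)
  rw [hinvol, hc', ← mul_assoc] at hcc
  have hc2 : (c : ℝ) * c = 1 := mul_right_cancel₀ hg.ne' (hcc.symm.trans (one_mul _).symm)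
  have hc1 : (c : ℝ) = 1 := by nlinarith [c.2]
  rw [hc', hc1, one_mul]

end ModularCharacter

/-! ### Densities, inner regularity and measurability of images. -/

section RegularMeasures

open Measure

variable {X : Type*} [TopologicalSpace X] [MeasurableSpace X] [BorelSpace X]

theorem withDensity_absolutelyContinuous_restrict_tsupport (μ : Measure X) (f : C_c(X, ℝ)) :
    μ.withDensity (fun x => ENNReal.ofReal (f x)) ≪ μ.restrict (tsupport f) := by
  have : (fun x => ENNReal.ofReal (f x)) =
      (tsupport f).indicator fun x => ENNReal.ofReal (f x) := by
    refine (indicator_eq_self.mpr fun x hx => subset_tsupport _ fun h => hx ?_).symm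
    simp [h]
  rw [this, withDensity_indicator (isClosed_tsupport f).measurableSet]
  exact withDensity_absolutelyContinuous _ _

theorem isFiniteMeasure_withDensity_compactlySupported (μ : Measure X)
    [IsFiniteMeasureOnCompacts μ] (f : C_c(X, ℝ)) :
    IsFiniteMeasure (μ.withDensity fun x => ENNReal.ofReal (f x)) :=
  isFiniteMeasure_withDensity_ofReal
    (f.continuous.integrable_of_hasCompactSupport f.hasCompactSupport).2

theorem isFiniteMeasure_restrict_tsupport {X : Type*} [TopologicalSpace X] [MeasurableSpace X]
    (μ : Measure X) [IsFiniteMeasureOnCompacts μ]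
    (f : C_c(X, ℝ)) : IsFiniteMeasure (μ.restrict (tsupport f)) :=
  isFiniteMeasure_restrict.mpr f.hasCompactSupport.measure_ne_top

theorem integral_withDensity_ofReal {E : Type*} [NormedAddCommGroup E] [NormedSpace ℝ E]
    (μ : Measure X) {f : X → ℝ} (hf : Continuous f) (hf0 : ∀ x, 0 ≤ f x) (g : X → E) :
    ∫ x, g x ∂(μ.withDensity fun x => ENNReal.ofReal (f x)) = ∫ x, f x • g x ∂μ := by
  have := integral_withDensity_eq_integral_smul (μ := μ)
    (continuous_real_toNNReal.comp hf).measurable g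
  refine this.trans (integral_congr_ae (.of_forall fun x => ?_))
  simp [NNReal.smul_def, hf0 x]

theorem integrable_withDensity_ofReal_iff {E : Type*} [NormedAddCommGroup E] [NormedSpace ℝ E]
    (μ : Measure X) {f : X → ℝ} (hf : Continuous f) (hf0 : ∀ x, 0 ≤ f x) (g : X → E) :
    Integrable g (μ.withDensity fun x => ENNReal.ofReal (f x)) ↔
      Integrable (fun x => f x • g x) μ := by
  have := integrable_withDensity_iff_integrable_smul (μ := μ)
    (continuous_real_toNNReal.comp hf).measurable (g := g)
  refine this.trans (integrable_congr (.of_forall fun x => ?_))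
  simp [NNReal.smul_def, hf0 x]

variable [T2Space X]

theorem exists_isCompact_seq_measure_sdiff_eq_zero (μ : Measure X) [IsFiniteMeasure μ]
    [μ.InnerRegular] {A : Set X} (hA : NullMeasurableSet A μ) :
    ∃ K : ℕ → Set X, (∀ n, IsCompact (K n)) ∧ (∀ n, K n ⊆ A) ∧ μ (A \ ⋃ n, K n) = 0 := by
  obtain ⟨B, hBA, hB, hAB⟩ := hA.exists_measurable_subset_ae_eq
  choose K hKB hK hKε using fun n : ℕ => hB.exists_isCompact_sdiff_lt (measure_ne_top μ B)
    (ε := ((n : ℝ≥0∞) + 1)⁻¹) (by simp)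
  refine ⟨K, hK, fun n => (hKB n).trans hBA, ?_⟩
  have h1 : μ (A \ B) = 0 := ae_le_set.mp hAB.symm.le
  have h2 : μ (B \ ⋃ n, K n) = 0 := by
    refine le_antisymm (ge_of_tendsto' ENNReal.tendsto_inv_nat_nhds_zero fun n => ?_) zero_le
    calc μ (B \ ⋃ n, K n) ≤ μ (B \ K n) := measure_mono (sdiff_subset_sdiff_right (subset_iUnion K n))
      _ ≤ ((n : ℝ≥0∞) + 1)⁻¹ := (hKε n).le
      _ ≤ (n : ℝ≥0∞)⁻¹ := ENNReal.inv_le_inv.mpr le_self_add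
  refine measure_mono_null ?_ (measure_union_null h1 h2)
  intro x hx
  by_cases hxB : x ∈ B
  · exact Or.inr ⟨hxB, hx.2⟩
  · exact Or.inl ⟨hx.1, hxB⟩

/-- Compacts exhausting a set up to a `μ`-null set also exhaust it up to a `μ'`-null set, and their
finite unions approach its `μ'`-measure; `μ'` need not be finite. -/
theorem innerRegular_of_absolutelyContinuous {μ μ' : Measure X} [IsFiniteMeasure μ]
    [μ.InnerRegular] (h : μ' ≪ μ) : μ'.InnerRegular := by
  refine ⟨fun A hA r hr => ?_⟩
  obtain ⟨K, hK, hKA, h0⟩ := exists_isCompact_seq_measure_sdiff_eq_zero μ hA.nullMeasurableSet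
  have hle : μ' A ≤ μ' (⋃ n, K n) := by
    rw [← union_sdiff_cancel (iUnion_subset hKA)]
    exact (measure_union_le _ _).trans (by simp [h h0])
  have hlt := hr.trans_le hle
  rw [measure_iUnion_eq_iSup_accumulate, lt_iSup_iff] at hlt
  obtain ⟨n, hn⟩ := hlt
  exact ⟨accumulate K n, iUnion₂_subset fun i _ => hKA i, isCompact_accumulate hK n, hn⟩

theorem innerRegular_withDensity_compactlySupported (μ : Measure X) [μ.Regular] (f : C_c(X, ℝ)) :
    (μ.withDensity fun x => ENNReal.ofReal (f x)).InnerRegular :=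
  have := isFiniteMeasure_restrict_tsupport μ f
  innerRegular_of_absolutelyContinuous (withDensity_absolutelyContinuous_restrict_tsupport μ f)

/-- If `φ ∘ q` is almost everywhere measurable for a finite inner regular measure and `q` is
continuous, then `φ` is almost everywhere measurable for the image measure. -/
theorem aemeasurable_map_of_comp {Y β : Type*} [TopologicalSpace Y] [T2Space Y]
    [MeasurableSpace Y] [BorelSpace Y] [MeasurableSpace β] [MeasurableSpace.CountablyGenerated β]
    [Nonempty β]
    (μ : Measure X) [IsFiniteMeasure μ] [μ.InnerRegular] {q : X → Y} (hq : Continuous q)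
    {φ : Y → β} (hφ : AEMeasurable (φ ∘ q) μ) : AEMeasurable φ (μ.map q) := by
  refine NullMeasurable.aemeasurable fun s hs => ?_
  have hA : NullMeasurableSet (q ⁻¹' (φ ⁻¹' s)) μ := hφ.nullMeasurable hs
  obtain ⟨K, hK, hKA, hK0⟩ := exists_isCompact_seq_measure_sdiff_eq_zero μ hA
  obtain ⟨K', hK', hKA', hK0'⟩ := exists_isCompact_seq_measure_sdiff_eq_zero μ hA.compl
  have hm : ∀ K : ℕ → Set X, (∀ n, IsCompact (K n)) → MeasurableSet (⋃ n, q '' K n) :=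
    fun K hK => .iUnion fun n => ((hK n).image hq).measurableSet
  -- Both the preimage of `φ⁻¹' s` and its complement are exhausted by compacts. Their images are
  -- Borel, and only a null set escapes both.
  have hnull : μ.map q ((⋃ n, q '' K n) ∪ ⋃ n, q '' K' n)ᶜ = 0 := by
    rw [map_apply hq.measurable ((hm K hK).union (hm K' hK')).compl]
    refine measure_mono_null ?_ (measure_union_null hK0 hK0')
    intro x hx
    have h1 : x ∉ ⋃ n, K n := fun h => hx (Or.inl (by
      obtain ⟨n, hn⟩ := mem_iUnion.mp h
      exact mem_iUnion.mpr ⟨n, x, hn, rfl⟩))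
    have h2 : x ∉ ⋃ n, K' n := fun h => hx (Or.inr (by
      obtain ⟨n, hn⟩ := mem_iUnion.mp h
      exact mem_iUnion.mpr ⟨n, x, hn, rfl⟩))
    by_cases hxs : x ∈ q ⁻¹' (φ ⁻¹' s)
    · exact Or.inl ⟨hxs, h1⟩
    · exact Or.inr ⟨hxs, h2⟩
  have hsub : (⋃ n, q '' K n) ⊆ φ ⁻¹' s :=
    iUnion_subset fun n => image_subset_iff.mpr (hKA n)
  have hsub' : (⋃ n, q '' K' n) ⊆ (φ ⁻¹' s)ᶜ :=
    iUnion_subset fun n => image_subset_iff.mpr (hKA' n)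
  rw [← union_sdiff_cancel hsub]
  refine (hm K hK).nullMeasurableSet.union (NullMeasurableSet.of_null (measure_mono_null ?_ hnull))
  rintro y ⟨hy, hy'⟩ (h | h)
  · exact hy' h
  · exact hsub' h hy

end RegularMeasures

/-! ### Weil's integration formula. -/

section Weil

/-- Every function in `C_c(G/L)` is a coset integral, so `c = 0` would make `ν` integrate all of
them to zero. -/
theorem ne_zero_of_integral_cosetIntegral_eq {G : Type*} [Group G]
    [TopologicalSpace G] [IsTopologicalGroup G] [LocallyCompactSpace G] [T2Space G]
    [MeasurableSpace G] [BorelSpace G] {L : Subgroup G} {hL : IsClosed (L : Set G)}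
    {lam : Measure L} [lam.IsHaarMeasure] {m : Measure G} {ν : Measure (CosetSpace G L)}
    [ν.Regular] {c : ℝ≥0} (hν : ν ≠ 0)
    (hc : ∀ f : C_c(G, ℝ), ∫ z, cosetIntegral hL lam f z ∂ν = c * ∫ x, f x ∂m) : c ≠ 0 := by
  rintro rfl
  have := t2Space_of_isClosed hL
  refine hν (Measure.ext_of_integral_eq_on_compactlySupported fun g => ?_)
  obtain ⟨χ, -, hχ⟩ := exists_cosetIntegral_eq_one hL lam g.hasCompactSupport
  have e : ∀ z, g z = cosetIntegral hL lam (mulPullback χ g g.continuous) z := by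
    intro z
    rw [cosetIntegral_mulPullback]
    by_cases hz : z ∈ tsupport g
    · simp [hχ z hz]
    · simp [image_eq_zero_of_notMem_tsupport hz]
  simp_rw [e, hc]
  simp

variable {G : Type*} [Group G] [TopologicalSpace G] [IsTopologicalGroup G]
  [LocallyCompactSpace G] [T2Space G] [MeasurableSpace G] [BorelSpace G]
  {L : Subgroup G} (hL : IsClosed (L : Set G)) (lam : Measure L) [lam.IsHaarMeasure]
  (m : Measure G) [m.IsHaarMeasure]
  (ν : Measure (CosetSpace G L)) [ν.Regular]

/-- Weil's integration formula. -/
theorem exists_integral_cosetIntegral_eq [SMulInvariantMeasure G (CosetSpace G L) ν] :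
    ∃ c : ℝ≥0, ∀ f : C_c(G, ℝ), ∫ z, cosetIntegral hL lam f z ∂ν = c * ∫ x, f x ∂m := by
  have := t2Space_of_isClosed hL
  let Λ : C_c(G, ℝ) →ₗ[ℝ] ℝ :=
    { toFun := fun f => ∫ z, cosetIntegral hL lam f z ∂ν
      map_add' := fun f g => by
        rw [map_add]
        exact integral_add
          ((map_continuous _).integrable_of_hasCompactSupport (cosetIntegral hL lam f).2)
          ((map_continuous _).integrable_of_hasCompactSupport (cosetIntegral hL lam g).2)
      map_smul' := fun c f => by
        rw [map_smul]; exact integral_smul c _ }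
  refine exists_eq_integral_of_leftInvariant m Λ
    (fun f hf => integral_nonneg (cosetIntegral_nonneg hL lam hf)) fun f f' y h => ?_
  have e : ∀ z, cosetIntegral hL lam f' z = cosetIntegral hL lam f (y • z) := by
    intro z
    obtain ⟨x, rfl⟩ := mk_surjective L z
    simp only [smul_mk, cosetIntegral_mk, h, mul_assoc]
  change ∫ z, cosetIntegral hL lam f' z ∂ν = ∫ z, cosetIntegral hL lam f z ∂ν
  simp_rw [e]
  exact integral_smul_eq_self (fun z => cosetIntegral hL lam f z)

variable {hL lam m ν}

/-- Weil's formula as an equality of measures on `G/L`. -/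
theorem withDensity_cosetIntegral_eq_map [m.Regular] {c : ℝ≥0}
    (hc : ∀ f : C_c(G, ℝ), ∫ z, cosetIntegral hL lam f z ∂ν = c * ∫ x, f x ∂m)
    {χ : C_c(G, ℝ)} (hχ : ∀ x, 0 ≤ χ x) :
    ν.withDensity (fun z => ENNReal.ofReal (cosetIntegral hL lam χ z)) =
      c • (m.withDensity fun x => ENNReal.ofReal (χ x)).map (mk L) := by
  have := t2Space_of_isClosed hL
  have := isFiniteMeasure_withDensity_compactlySupported ν (cosetIntegral hL lam χ)
  have := innerRegular_withDensity_compactlySupported ν (cosetIntegral hL lam χ)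
  have := isFiniteMeasure_withDensity_compactlySupported m χ
  have := innerRegular_withDensity_compactlySupported m χ
  have : ((m.withDensity fun x => ENNReal.ofReal (χ x)).map (mk L)).InnerRegular :=
    Measure.InnerRegular.map_of_continuous (continuous_mk L)
  refine Measure.ext_of_integral_eq_on_compactlySupported fun g => ?_
  rw [integral_withDensity_ofReal ν (map_continuous _) (cosetIntegral_nonneg hL lam hχ),
    integral_smul_nnreal_measure,
    integral_map (continuous_mk L).aemeasurable (map_continuous g).aestronglyMeasurable,
    integral_withDensity_ofReal m (map_continuous χ) hχ]
  have := hc (mulPullback χ g g.continuous)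
  simp_rw [cosetIntegral_mulPullback] at this
  exact this

/-- The density `P_L χ` is `1` wherever `F` is nonzero, so it may be inserted for free. The equality
of measures then applies to functions that are merely measurable, such as `ρ f`. -/
theorem integrable_and_integral_eq_of_cosetIntegral_eq_one [m.Regular] {c : ℝ≥0}
    (hc : ∀ f : C_c(G, ℝ), ∫ z, cosetIntegral hL lam f z ∂ν = c * ∫ x, f x ∂m)
    {χ : C_c(G, ℝ)} (hχ : ∀ x, 0 ≤ χ x)
    {E : Type*} [NormedAddCommGroup E] [NormedSpace ℝ E] {F : CosetSpace G L → E}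
    (hF : ∀ z, F z ≠ 0 → cosetIntegral hL lam χ z = 1)
    (hFm : AEStronglyMeasurable F ((m.withDensity fun x => ENNReal.ofReal (χ x)).map (mk L)))
    (hFi : Integrable (fun x => χ x • F (mk L x)) m) :
    Integrable F ν ∧ ∫ z, F z ∂ν = (c : ℝ) • ∫ x, χ x • F (mk L x) ∂m := by
  have := t2Space_of_isClosed hL
  have e : F = fun z => cosetIntegral hL lam χ z • F z := by
    ext z
    by_cases hz : F z = 0
    · simp [hz]
    · simp [hF z hz]
  have hP := cosetIntegral_nonneg hL lam hχ
  constructor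
  · rw [e, ← integrable_withDensity_ofReal_iff ν (map_continuous _) hP,
      withDensity_cosetIntegral_eq_map hc hχ]
    refine Integrable.smul_measure_nnreal ?_
    rw [integrable_map_measure hFm (continuous_mk L).aemeasurable]
    exact (integrable_withDensity_ofReal_iff m (map_continuous χ) hχ _).mpr hFi
  · conv_lhs => rw [e]
    rw [← integral_withDensity_ofReal ν (map_continuous _) hP,
      withDensity_cosetIntegral_eq_map hc hχ, integral_smul_nnreal_measure,
      integral_map (continuous_mk L).aemeasurable hFm,
      integral_withDensity_ofReal m (map_continuous χ) hχ]
    rfl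

end Weil

/-! ### Descending a measure from `G` to `G/H`. -/

section QuotientMeasure

open Measure

variable {G : Type*} [Group G] [TopologicalSpace G] [IsTopologicalGroup G]
  [LocallyCompactSpace G] [T2Space G] [MeasurableSpace G] [BorelSpace G]
  {H : Subgroup G} (hH : IsClosed (H : Set G)) [LocallyCompactSpace H] (κ : Measure H)
  [κ.IsHaarMeasure] [κ.Regular]
  {m : Measure G} [IsFiniteMeasureOnCompacts m]

theorem hasCompactSupport_mul_mul_subgroup {G : Type*} [Group G] [TopologicalSpace G]
    [IsTopologicalGroup G] [T2Space G] {H : Subgroup G} (hH : IsClosed (H : Set G))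
    (F : G → H → ℝ) {K K' : Set G} (hK : IsCompact K) (hK' : IsCompact K')
    (hF : ∀ x h, F x h ≠ 0 → x ∈ K ∧ x * h ∈ K') : HasCompactSupport F.uncurry := by
  have hC : IsCompact ((↑) ⁻¹' (K⁻¹ * K') : Set H) :=
    hH.isClosedEmbedding_subtypeVal.isCompact_preimage (hK.inv.mul hK')
  refine HasCompactSupport.intro (hK.prod hC) ?_
  rintro ⟨x, h⟩ hx
  by_contra hne
  obtain ⟨h1, h2⟩ := hF x h hne
  exact hx ⟨h1, x⁻¹, Set.inv_mem_inv.mpr h1, x * h, h2, by simp⟩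

/-- By Fubini, substitute `x ↦ xh⁻¹` in `G`, then `h ↦ h⁻¹` in `H`: the modular character created by
the first is absorbed by the second. This symmetry is what shows that `∫ φ dm` depends only on `P_H
φ`. -/
theorem integral_mul_cosetIntegral_comm
    (hm : ∀ (φ : C_c(G, ℝ)) (h : H),
      ∫ x, φ (x * h) ∂m = (modularCharacter h : ℝ) * ∫ x, φ x ∂m) (φ ψ : C_c(G, ℝ)) :
    ∫ x, ψ x * cosetIntegral hH κ φ (mk H x) ∂m =
      ∫ x, φ x * cosetIntegral hH κ ψ (mk H x) ∂m := by
  have hφ := φ.continuous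
  have hψ := ψ.continuous
  calc ∫ x, ψ x * cosetIntegral hH κ φ (mk H x) ∂m
      = ∫ x, ∫ h : H, ψ x * φ (x * h) ∂κ ∂m := by
        simp_rw [cosetIntegral_mk, integral_const_mul]
    _ = ∫ h : H, ∫ x, ψ x * φ (x * h) ∂m ∂κ := by
        refine integral_integral_swap_of_hasCompactSupport ?_ ?_
        · exact (hψ.comp continuous_fst).mul
            (hφ.comp (continuous_fst.mul (continuous_subtype_val.comp continuous_snd)))
        · exact hasCompactSupport_mul_mul_subgroup hH _ ψ.hasCompactSupport φ.hasCompactSupport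
            fun x h hne => ⟨subset_tsupport _ (left_ne_zero_of_mul hne),
              subset_tsupport _ (right_ne_zero_of_mul hne)⟩
    _ = ∫ h : H, ∫ x, φ x * ((modularCharacter h : ℝ) * ψ (x * (h⁻¹ : H))) ∂m ∂κ := by
        congr 1 with h
        have := hm ⟨⟨fun x => φ x * ψ (x * (h⁻¹ : H)), by fun_prop⟩,
          φ.hasCompactSupport.mul_right⟩ h
        change ∫ x, φ (x * h) * ψ (x * h * (h⁻¹ : H)) ∂m
          = _ * ∫ x, φ x * ψ (x * (h⁻¹ : H)) ∂m at this
        rw [← integral_const_mul] at this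
        refine Eq.trans ?_ (this.trans ?_) <;> refine integral_congr_ae (.of_forall fun x => ?_)
        · simp [mul_comm]
        · exact mul_left_comm _ _ _
    _ = ∫ x, ∫ h : H, φ x * ((modularCharacter h : ℝ) * ψ (x * (h⁻¹ : H))) ∂κ ∂m := by
        refine (integral_integral_swap_of_hasCompactSupport ?_ ?_).symm
        · exact (hφ.comp continuous_fst).mul
            ((continuous_modularCharacter.comp continuous_snd).mul
              (hψ.comp (continuous_fst.mul
                (continuous_subtype_val.comp (continuous_inv.comp continuous_snd)))))
        · have := (hasCompactSupport_mul_mul_subgroup hH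
            (fun x h => φ x * ((modularCharacter h⁻¹ : ℝ) * ψ (x * h)))
            φ.hasCompactSupport ψ.hasCompactSupport
            fun x h hne => ⟨subset_tsupport _ (left_ne_zero_of_mul hne),
              subset_tsupport _ (right_ne_zero_of_mul
                (right_ne_zero_of_mul hne))⟩).comp_homeomorph
            ((Homeomorph.refl G).prodCongr (Homeomorph.inv H))
          exact (congrArg HasCompactSupport (funext fun ⟨x, h⟩ => by simp)).mpr this
    _ = ∫ x, φ x * cosetIntegral hH κ ψ (mk H x) ∂m := by
        congr 1 with x
        rw [integral_const_mul, cosetIntegral_mk]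
        congr 1
        exact integral_modularInversion κ ⟨⟨fun h : H => ψ (x * h), by fun_prop⟩,
          hasCompactSupport_mul_subgroup hH ψ.hasCompactSupport x⟩

/-- A measure on `G` that transforms under right translation by `H` like the Haar measure of `H`
descends to `G/H`. -/
theorem exists_regular_integral_cosetIntegral_eq
    (hm : ∀ (φ : C_c(G, ℝ)) (h : H),
      ∫ x, φ (x * h) ∂m = (modularCharacter h : ℝ) * ∫ x, φ x ∂m) :
    ∃ μ : Measure (CosetSpace G H), μ.Regular ∧
      ∀ φ : C_c(G, ℝ), ∫ z, cosetIntegral hH κ φ z ∂μ = ∫ x, φ x ∂m := by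
  have := t2Space_of_isClosed hH
  have hint : ∀ φ : C_c(G, ℝ), Integrable φ m := fun φ =>
    φ.continuous.integrable_of_hasCompactSupport φ.hasCompactSupport
  -- With `P_H ψ = 1` on the images of both supports, `∫ φ = ∫ φ · P_H ψ = ∫ ψ · P_H φ`, and
  -- likewise for `φ'`.
  have hwd : ∀ φ φ' : C_c(G, ℝ), cosetIntegral hH κ φ = cosetIntegral hH κ φ' →
      ∫ x, φ x ∂m = ∫ x, φ' x ∂m := by
    intro φ φ' h
    obtain ⟨ψ, -, hψ⟩ := exists_cosetIntegral_eq_one hH κ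
      ((φ.hasCompactSupport.union φ'.hasCompactSupport).image (continuous_mk H))
    have key : ∀ f : C_c(G, ℝ), tsupport f ⊆ tsupport φ ∪ tsupport φ' →
        ∫ x, f x ∂m = ∫ x, ψ x * cosetIntegral hH κ f (mk H x) ∂m := by
      intro f hf
      rw [integral_mul_cosetIntegral_comm hH κ hm]
      congr 1 with x
      by_cases hx : x ∈ tsupport f
      · rw [hψ _ ⟨x, hf hx, rfl⟩, mul_one]
      · rw [image_eq_zero_of_notMem_tsupport hx, zero_mul]
    rw [key φ subset_union_left, key φ' subset_union_right, h]
  -- `P_H` is onto, with nonnegative lifts of nonnegative functions. The chosen lift need not be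
  -- linear, but `hwd` makes its integral linear.
  have hsec : ∀ g : C_c(CosetSpace G H, ℝ), ∃ φ : C_c(G, ℝ), cosetIntegral hH κ φ = g ∧
      ((∀ z, 0 ≤ g z) → ∀ x, 0 ≤ φ x) := by
    intro g
    obtain ⟨χ, hχ0, hχ⟩ := exists_cosetIntegral_eq_one hH κ g.hasCompactSupport
    refine ⟨mulPullback χ g g.continuous, ?_, fun hg x => mul_nonneg (hχ0 x) (hg _)⟩
    ext z
    rw [cosetIntegral_mulPullback]
    by_cases hz : z ∈ tsupport g
    · rw [hχ z hz, one_smul]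
    · rw [image_eq_zero_of_notMem_tsupport hz, smul_zero]
  choose s hs hs0 using hsec
  let Λ : C_c(CosetSpace G H, ℝ) →ₗ[ℝ] ℝ :=
    { toFun := fun g => ∫ x, s g x ∂m
      map_add' := fun g g' => by
        rw [hwd (s (g + g')) (s g + s g') (by simp only [map_add, hs])]
        exact integral_add (hint _) (hint _)
      map_smul' := fun c g => by
        rw [hwd (s (c • g)) (c • s g) (by simp only [map_smul, hs])]
        exact integral_smul c _ }
  let Λ' : C_c(CosetSpace G H, ℝ) →ₚ[ℝ] ℝ :=
    PositiveLinearMap.mk₀ Λ fun g hg => integral_nonneg (hs0 g hg)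
  refine ⟨RealRMK.rieszMeasure Λ', inferInstance, fun φ => ?_⟩
  exact (RealRMK.integral_rieszMeasure Λ' (cosetIntegral hH κ φ)).trans (hwd _ _ (hs _))

end QuotientMeasure

/-! ### Measures and measurability from a rho-function. -/

section RhoFunction

open Measure

variable {G : Type*} [Group G] [TopologicalSpace G] [IsTopologicalGroup G]
  [LocallyCompactSpace G] [MeasurableSpace G] [BorelSpace G]

/-- The factor from translating Haar measure of `G` cancels the `G`-part of the rule for `ρ`,
leaving the character of `H` needed for descent. -/
theorem IsRhoFunction.integral_smul_mul_right {H : Subgroup G} {hH : IsClosed (H : Set G)}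
    [LocallyCompactSpace H] {ρ : G → ℝ} (hρ : IsRhoFunction H hH ρ) (φ : G → ℝ) (h : H) :
    ∫ x, ρ x • φ (x * h) ∂(haar : Measure G) =
      (modularCharacter h : ℝ) * ∫ x, ρ x • φ x ∂(haar : Measure G) := by
  have h1 := (modularCharacter_pos (h : G)).ne'
  have h2 := (modularCharacter_pos h).ne'
  have key : ∀ x, ρ x = (modularCharacter h : ℝ) * (modularCharacter (h : G) : ℝ)⁻¹
      * ρ (x * h) := by
    intro x
    have e : ρ (x * h) = (modularCharacter h : ℝ)⁻¹ * ((modularCharacter (h : G) : ℝ)⁻¹)⁻¹ * ρ x :=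
      hρ.apply_mul x h
    rw [e]
    field_simp
  calc ∫ x, ρ x • φ (x * h) ∂(haar : Measure G)
      = ∫ x, ((modularCharacter h : ℝ) * (modularCharacter (h : G) : ℝ)⁻¹) *
          (ρ (x * h) • φ (x * h)) ∂(haar : Measure G) := by
        congr 1 with x
        rw [key x]
        simp only [smul_eq_mul]
        ring
    _ = _ := by
        rw [integral_const_mul,
          integral_mul_right_eq_modularCharacter (haar : Measure G) (fun x => ρ x • φ x) (h : G),
          smul_eq_mul]
        field_simp

variable [T2Space G]

/-- The quasi-invariant measure on `G/H` attached to a rho-function. -/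
theorem IsRhoFunction.exists_regular_integral_cosetIntegral_eq {H : Subgroup G}
    {hH : IsClosed (H : Set G)} [LocallyCompactSpace H] {ρ : G → ℝ} (hρ : IsRhoFunction H hH ρ)
    (κ : Measure H) [κ.IsHaarMeasure] [κ.Regular] :
    ∃ μ : Measure (CosetSpace G H), μ.Regular ∧
      ∀ φ : C_c(G, ℂ), ∫ z, cosetIntegral hH κ φ z ∂μ = ∫ x, ρ x • φ x ∂(haar : Measure G) := by
  have := t2Space_of_isClosed hH
  have hint : ∀ {E : Type} [NormedAddCommGroup E] [NormedSpace ℝ E] (φ : C_c(G, E)),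
      Integrable (fun x => ρ x • φ x) (haar : Measure G) := fun φ =>
    hρ.locallyIntegrable.integrable_smul_right_of_hasCompactSupport φ.continuous
      φ.hasCompactSupport
  let Λ : C_c(G, ℝ) →ₗ[ℝ] ℝ :=
    { toFun := fun φ => ∫ x, ρ x • φ x ∂(haar : Measure G)
      map_add' := fun φ φ' => by
        rw [← integral_add (hint φ) (hint φ')]
        exact integral_congr_ae (.of_forall fun x => smul_add _ _ _)
      map_smul' := fun c φ => by
        refine Eq.trans (integral_congr_ae (.of_forall fun x => ?_)) (integral_smul c _)
        exact smul_comm (ρ x) c (φ x) }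
  let Λ' : C_c(G, ℝ) →ₚ[ℝ] ℝ := PositiveLinearMap.mk₀ Λ fun φ hφ =>
    integral_nonneg fun x => mul_nonneg (hρ.nonneg x) (hφ x)
  have hΛ : ∀ φ : C_c(G, ℝ), ∫ x, φ x ∂(RealRMK.rieszMeasure Λ') =
      ∫ x, ρ x • φ x ∂(haar : Measure G) := fun φ => RealRMK.integral_rieszMeasure Λ' φ
  obtain ⟨μ, hμ, hμP⟩ := _root_.exists_regular_integral_cosetIntegral_eq hH κ
    (m := RealRMK.rieszMeasure Λ') (fun φ h => by
      rw [hΛ, ← hρ.integral_smul_mul_right φ h]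
      exact hΛ (φ.comp (Homeomorph.mulRight (h : G)).toCocompactMap))
  refine ⟨μ, hμ, fun φ => ?_⟩
  -- The real case extends to complex values by testing on real and imaginary parts.
  have key : ∀ T : ℂ →L[ℝ] ℝ, T (∫ z, cosetIntegral hH κ φ z ∂μ) =
      T (∫ x, ρ x • φ x ∂(haar : Measure G)) := by
    intro T
    have hTφ : HasCompactSupport fun x => T (φ x) := φ.hasCompactSupport.comp_left (map_zero T)
    let ψ : C_c(G, ℝ) := ⟨⟨fun x => T (φ x), T.continuous.comp φ.continuous⟩, hTφ⟩
    have hPint : Integrable (cosetIntegral hH κ φ) μ :=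
      (map_continuous _).integrable_of_hasCompactSupport (cosetIntegral hH κ φ).2
    have h1 := T.integral_comp_comm hPint
    have h2 := T.integral_comp_comm (hint φ)
    rw [← h1, ← h2]
    have e : ∀ z, T (cosetIntegral hH κ φ z) = cosetIntegral hH κ ψ z := by
      intro z
      obtain ⟨x, rfl⟩ := mk_surjective H z
      exact (T.integral_comp_comm (integrable_mul_subgroup hH κ φ x)).symm
    rw [integral_congr_ae (.of_forall e), hμP ψ, hΛ ψ]
    exact integral_congr_ae (.of_forall fun x => (T.map_smul (ρ x) (φ x)).symm)
  exact Complex.ext (key Complex.reCLM) (key Complex.imCLM)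

/-- Its pullback to `G` is `ρ`, integrable on the compact support of `χ`, so
`aemeasurable_map_of_comp` applies. -/
theorem IsRhoFunction.aestronglyMeasurable_onCosetSpace {H L : Subgroup G}
    {hH : IsClosed (H : Set G)} (hL : IsClosed (L : Set G)) {ρ : G → ℝ}
    (hρ : IsRhoFunction H hH ρ) (hLH : L ≤ H) (hGH : ∀ l : L, modularFunction (l : G) =
      subgroupModularFunction H hH (Subgroup.inclusion hLH l)) (χ : C_c(G, ℝ)) :
    AEStronglyMeasurable (hρ.onCosetSpace hLH hGH)
      (((haar : Measure G).withDensity fun x => ENNReal.ofReal (χ x)).map (CosetSpace.mk L)) := by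
  have := t2Space_of_isClosed hL
  have := isFiniteMeasure_withDensity_compactlySupported (haar : Measure G) χ
  have := innerRegular_withDensity_compactlySupported (haar : Measure G) χ
  refine (aemeasurable_map_of_comp _ (continuous_mk L) ?_).aestronglyMeasurable
  exact (hρ.locallyIntegrable.integrableOn_isCompact χ.hasCompactSupport).1.aemeasurable.mono_ac
    (withDensity_absolutelyContinuous_restrict_tsupport _ χ)

end RhoFunction

/-! ### Assembling the Radon transform formula. -/

theorem CosetSpace.continuous_incl {G : Type*} [Group G] [TopologicalSpace G]
    [IsTopologicalGroup G] (L H : Subgroup G) : Continuous (incl L H) :=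
  (isOpenQuotientMap_mk (L.subgroupOf H)).continuous_comp_iff.mp
    ((continuous_mk L).comp continuous_subtype_val)

/-- A Haar measure on `L`, regarded as a subgroup of `H`, gives a Haar measure on `L`. -/
theorem isHaarMeasure_map_subgroupOf {G : Type*} [Group G] [TopologicalSpace G]
    [IsTopologicalGroup G] [MeasurableSpace G] [BorelSpace G] {H L : Subgroup G} (hLH : L ≤ H)
    (lam : Measure (L.subgroupOf H)) [lam.IsHaarMeasure] :
    (lam.map (Subgroup.subgroupOfEquivOfLe hLH)).IsHaarMeasure :=
  (Subgroup.subgroupOfEquivOfLe hLH).isHaarMeasure_map lam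
    ((continuous_subtype_val.comp continuous_subtype_val).subtype_mk _)
    ((continuous_subtype_val.subtype_mk _).subtype_mk _)

theorem theorem3p6 {G : Type*} [Group G] [TopologicalSpace G] [IsTopologicalGroup G]
    [LocallyCompactSpace G] [T2Space G] [MeasurableSpace G] [BorelSpace G]
    (H L : Subgroup G) (hH : IsClosed (H : Set G)) (hL : IsClosed (L : Set G)) (hLH : L ≤ H)
    (hGH : ∀ l : L, modularFunction (l : G) =
      subgroupModularFunction H hH (Subgroup.inclusion hLH l))
    (hHL : ∀ l : L, subgroupModularFunction H hH (Subgroup.inclusion hLH l) =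
      subgroupModularFunction L hL l)
    (ρ : G → ℝ) (hρ : IsRhoFunction H hH ρ)
    (ν : Measure (CosetSpace G L)) [ν.Regular] [SMulInvariantMeasure G (CosetSpace G L) ν]
    (η : Measure (CosetSpace H (L.subgroupOf H))) [η.Regular]
    [SMulInvariantMeasure H (CosetSpace H (L.subgroupOf H)) η] (hη : η ≠ 0) :
    ∃ μ : Measure (CosetSpace G H), μ.Regular ∧
      ∀ f : C_c(CosetSpace G L, ℂ),
        Integrable (radonTransform L H η f) μ ∧
        Integrable (fun z => (hρ.onCosetSpace hLH hGH z : ℂ) * f z) ν ∧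
        ∫ y, radonTransform L H η f y ∂μ =
          ∫ z, (hρ.onCosetSpace hLH hGH z : ℂ) * f z ∂ν := by
  have : LocallyCompactSpace H := hH.isClosedEmbedding_subtypeVal.locallyCompactSpace
  have := t2Space_of_isClosed hH
  have := t2Space_of_isClosed hL
  have hL' : IsClosed (L.subgroupOf H : Set H) := hL.preimage continuous_subtype_val
  have : LocallyCompactSpace (L.subgroupOf H) :=
    hL'.isClosedEmbedding_subtypeVal.locallyCompactSpace
  let m : Measure G := Measure.haar
  let κ : Measure H := Measure.haar
  let lam' : Measure (L.subgroupOf H) := Measure.haar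
  -- Transporting one Haar measure makes coset integrals over `L` agree whether computed inside `H`
  -- or inside `G`.
  let lam : Measure L := lam'.map (Subgroup.subgroupOfEquivOfLe hLH)
  have : lam.IsHaarMeasure := isHaarMeasure_map_subgroupOf hLH lam'
  obtain ⟨c, hc⟩ := exists_integral_cosetIntegral_eq hL lam m ν
  obtain ⟨c', hc'⟩ := exists_integral_cosetIntegral_eq hL' lam' κ η
  have hc'0 : (c' : ℝ) ≠ 0 := NNReal.coe_ne_zero.mpr (ne_zero_of_integral_cosetIntegral_eq hη hc')
  obtain ⟨μ, hμ, hμP⟩ := hρ.exists_regular_integral_cosetIntegral_eq κ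
  refine ⟨(c / c') • μ, inferInstance, fun f => ?_⟩
  obtain ⟨χ, hχ0, hχ⟩ := exists_cosetIntegral_eq_one hL lam f.hasCompactSupport
  let φ : C_c(G, ℂ) := mulPullback χ f f.continuous
  -- On the fibre through `x`, the function `h ↦ χ(xh)` has coset integral `1` wherever `f(xhL) ≠
  -- 0`, so Weil's formula on `H/L` unfolds the transform into an integral over `H`.
  have hR : radonTransform L H η f = fun z => (c' : ℝ) • cosetIntegral hH κ φ z := by
    ext z
    obtain ⟨x, rfl⟩ := mk_surjective H z
    let χx : C_c(H, ℝ) := ⟨⟨fun h => χ (x * h), by have := χ.continuous; fun_prop⟩,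
      hasCompactSupport_mul_subgroup hH χ.hasCompactSupport x⟩
    have hP : ∀ w, cosetIntegral hL' lam' χx w = cosetIntegral hL lam χ (x • incl L H w) := by
      intro w
      obtain ⟨h, rfl⟩ := mk_surjective _ w
      rw [incl_mk, smul_mk, cosetIntegral_mk, cosetIntegral_mk, integral_map]
      · exact integral_congr_ae (.of_forall fun l => congrArg χ (mul_assoc _ _ _).symm)
      · exact ((continuous_subtype_val.comp continuous_subtype_val).subtype_mk _).aemeasurable
      · exact (χ.continuous.comp
          (continuous_const.mul continuous_subtype_val)).aestronglyMeasurable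
    exact (integrable_and_integral_eq_of_cosetIntegral_eq_one hc' (χ := χx) (fun h => hχ0 _)
      (F := fun w => f (x • incl L H w))
      (fun w hw => (hP w).trans (hχ _ (subset_tsupport _ hw)))
      (f.continuous.comp ((continuous_incl L H).const_smul x)).aestronglyMeasurable
      (integrable_mul_subgroup hH κ φ x)).2
  have hφi : Integrable (cosetIntegral hH κ φ) μ :=
    (map_continuous _).integrable_of_hasCompactSupport (cosetIntegral hH κ φ).2
  have hρφ : ∀ x, χ x • ((hρ.onCosetSpace hLH hGH (mk L x) : ℂ) * f (mk L x)) = ρ x • φ x := by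
    intro x
    change χ x • ((ρ x : ℂ) * f (mk L x)) = ρ x • (χ x • f (mk L x))
    simp only [Complex.real_smul]
    ring
  obtain ⟨hi, hI⟩ := integrable_and_integral_eq_of_cosetIntegral_eq_one hc hχ0
    (F := fun z => (hρ.onCosetSpace hLH hGH z : ℂ) * f z)
    (fun z hz => hχ z (subset_tsupport _ (right_ne_zero_of_mul hz)))
    ((Complex.continuous_ofReal.comp_aestronglyMeasurable
      (hρ.aestronglyMeasurable_onCosetSpace hL hLH hGH χ)).mul
      (map_continuous f).aestronglyMeasurable)
    (by
      simp_rw [hρφ]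
      exact hρ.locallyIntegrable.integrable_smul_right_of_hasCompactSupport φ.continuous
        φ.hasCompactSupport)
  refine ⟨?_, hi, ?_⟩
  · rw [hR]
    exact (hφi.smul (c' : ℝ)).smul_measure_nnreal
  · rw [hI, hR, integral_smul, integral_smul_nnreal_measure, hμP]
    simp_rw [hρφ]
    rw [NNReal.smul_def, smul_smul, NNReal.coe_div, mul_div_cancel₀ _ hc'0]

end
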